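/- **Setting.** A periodic graph in $\mathbb{R}^d$ is a connected, locally finite simple graph $\Gamma$ whose vertices are distinct points of $\mathbb{R}^d$, whose vertex set $V$ and edge set are invariant under translation by linearly independent vectors $\mathfrak a_1,\dots,\mathfrak a_d$, and whose fundamental crystal $V_f = V\cap\{\sum_i x_i\mathfrak a_i : x\in[0,1)^d\}$ is finite, with $\nu$ vertices. Each $v\in V$ is written $v=\lfloor v\rfloor_{\mathfrak a}+\{v\}_{\mathfrak a}$ with $\lfloor v\rfloor_{\mathfrak a}\in\bigoplus_i\mathbb{Z}\mathfrak a_i$ and $\{v\}_{\mathfrak a}\in V_f$. A potential $Q:V\to\mathbb{R}$ is periodic if $Q(u)=Q(v)$ whenever $u=v+\mathfrak a_i$. The Schrödinger operator is $(H\psi)(v)=\sum_{u\sim v}\psi(u)+Q(v)\psi(v)$ on $\ell^2(V)$. It has purely absolutely continuous spectrum if it is a bounded self-adjoint operator all of whose spectral measures $\mu_\psi$, $\psi\in\ell^2(V)$, are absolutely continuous with respect to Lebesgue measure. With $\mathfrak b_1,\dots,\mathfrak b_d$ the dual basis, $\mathfrak a_i\cdot\mathfrak b_j=2\pi\delta_{ij}$,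 and $\theta_{\mathfrak b}=\sum_i\theta_i\mathfrak b_i$ for $\theta\in\mathbb{R}^d$, the Floquet matrix $H(\theta_{\mathfrak b})$ acts on $\ell^2(V_f)$ by $$H(\theta_{\mathfrak b})f(v)=\sum_{u\sim v}e^{\mathrm i\theta_{\mathfrak b}\cdot\lfloor u\rfloor_{\mathfrak a}}f(\{u\}_{\mathfrak a})+Q(v)f(v),$$ and $E_1(\theta_{\mathfrak b}),\dots,E_\nu(\theta_{\mathfrak b})$ are its eigenvalues with multiplicity (the Floquet eigenvalues). The Floquet assumption is that for all $s,w\in\{1,\dots,\nu\}$ $$\lim_{N\to\infty}\ \sup_{\substack{m\in\{0,\dots,N-1\}^d\\ m\ne0}}\ \frac{\#\{r\in\{0,\dots,N-1\}^d: E_s(\tfrac{r_{\mathfrak b}+m_{\mathfrak b}}{N})-E_w(\tfrac{r_{\mathfrak b}}{N})=0\}}{N^d}=0.$$ It is violated if it fails for every labelling of the eigenvalues. **Proposition.** There exist a dimension $d\ge1$, a periodic graph in $\mathbb{R}^d$ and a periodic potential such that the Schrödinger operator has purely absolutely continuous spectrum and the Floquet assumption is violated. An example, with $d=1$ and $Q=0$,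 is the tensor product $\mathbb{Z}\times(C_3\,\square\,P_4)$, where $\mathbb{Z}$ is the two-sided infinite path, $C_3$ the $3$-cycle, $P_4$ the path with $4$ vertices, $\square$ the Cartesian product, and $(u,v)\sim(u',v')$ in the tensor product iff $u\sim u'$ and $v\sim v'$. It can be realized as a periodic graph in $\mathbb{R}$ with translation by $\mathfrak a_1$ being $(n,x)\mapsto(n+1,x)$ and fundamental crystal $\{0\}\times V(C_3\,\square\,P_4)$, in such a way that the adjacency operator has purely absolutely continuous spectrum and the Floquet assumption is violated. Its Floquet eigenvalues are $2\mu_j\cos2\pi\theta$, $j=1,\dots,12$, where $\mu_1,\dots,\mu_{12}$ are the eigenvalues, with multiplicity, of the adjacency matrix of $C_3\,\square\,P_4$; all $\mu_j$ are nonzero, and both $\frac{3+\sqrt5}{2}$ and $-\frac{3+\sqrt5}{2}$ occur among them. -/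

import Mathlib

open scoped BoundedContinuousFunction

/-- The tensor (categorical) product of two graphs: `(u, v) ∼ (u', v')` iff `u ∼ u'` and
`v ∼ v'`. -/
def SimpleGraph.tensorProduct {α β : Type*} (G : SimpleGraph α) (H : SimpleGraph β) :
    SimpleGraph (α × β) where
  Adj x y := G.Adj x.1 y.1 ∧ H.Adj x.2 y.2
  symm := ⟨fun _ _ h => ⟨h.1.symm, h.2.symm⟩⟩
  loopless := ⟨fun _ h => G.irrefl h.1⟩

/-- A realization of the connected, locally finite graph `G` as a periodic graph in `ℝᵈ`:
the vertices are distinct points of `ℝᵈ`, the vertex set and the edges are invariant under the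
translations by the linearly independent vectors `a 0, …, a (d - 1)`, and there are finitely many
vertices in the basic cell `{∑ xᵢ aᵢ : x ∈ [0, 1)ᵈ}`. -/
structure PeriodicGraph {V : Type} (G : SimpleGraph V) (d : ℕ) where
  /-- position of the vertices -/
  pos : V → EuclideanSpace ℝ (Fin d)
  /-- the period vectors -/
  a : Module.Basis (Fin d) ℝ (EuclideanSpace ℝ (Fin d))
  pos_injective : Function.Injective pos
  exists_add : ∀ (i : Fin d) (v : V), ∃ u, pos u = pos v + a i
  exists_sub : ∀ (i : Fin d) (v : V), ∃ u, pos u = pos v - a i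
  adj_translate : ∀ (i : Fin d) (u v u' v' : V), pos u' = pos u + a i → pos v' = pos v + a i →
    (G.Adj u' v' ↔ G.Adj u v)
  finite_cell : {v : V | pos v ∈ ZSpan.fundamentalDomain a}.Finite
  finite_neighbors : ∀ v : V, (G.neighborSet v).Finite
  connected : G.Connected

namespace PeriodicGraph

variable {V : Type} {G : SimpleGraph V} {d : ℕ} (Γ : PeriodicGraph G d)

/-- The fundamental crystal `V_f`: the vertices in the basic cell. -/
def crystal : Set V := {v : V | Γ.pos v ∈ ZSpan.fundamentalDomain Γ.a}

noncomputable instance : Fintype Γ.crystal := Γ.finite_cell.fintype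

/-- The (finite) set of neighbours of a vertex. -/
noncomputable def nbrs (v : V) : Finset V := (Γ.finite_neighbors v).toFinset

/-- The coordinates, in the basis `a`, of the integer part `⌊v⌋` of a vertex. -/
noncomputable def cellIndex (v : V) : Fin d → ℤ := fun i => ⌊Γ.a.repr (Γ.pos v) i⌋

/-- A potential is periodic if it is invariant under the period translations. -/
def IsPeriodicPotential (Q : V → ℝ) : Prop :=
  ∀ (i : Fin d) (u v : V), Γ.pos u = Γ.pos v + Γ.a i → Q u = Q v

open Classical in
/-- The Floquet matrix `H(θ)`, acting on functions on the fundamental crystal by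
`(H(θ) f)(v) = ∑_{u ∼ v} exp(i θ_b · ⌊u⌋) f({u}) + Q(v) f(v)`, where `{u} = ZSpan.fract a u` is the
fractional part. As `b` is the dual basis, `a i · b j = 2π δ_{ij}`, the phase `θ_b · ⌊u⌋` is `2π`
times the sum of the `θ i * ⌊u⌋ i`. -/
noncomputable def floquetMatrix (Q : V → ℝ) (θ : Fin d → ℝ) : Matrix Γ.crystal Γ.crystal ℂ :=
  Matrix.of fun v w =>
    (∑ u ∈ Γ.nbrs v,
      if ZSpan.fract Γ.a (Γ.pos u) = Γ.pos w then
        Complex.exp (2 * Real.pi * Complex.I * (∑ i, θ i * Γ.cellIndex u i : ℝ))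
      else 0) +
    if v = w then (Q v : ℂ) else 0

open Classical in
/-- `(E s θ)_s` lists, for each `θ`, the eigenvalues of the Floquet matrix `H(θ)` with their
multiplicities. No continuity in `θ` is required of the labelling. -/
def IsFloquetEigenvalues (Q : V → ℝ) {ι : Type} [Fintype ι] (E : ι → (Fin d → ℝ) → ℝ) : Prop :=
  ∀ θ : Fin d → ℝ, (Γ.floquetMatrix Q θ).charpoly =
    ∏ s, (Polynomial.X - Polynomial.C (E s θ : ℂ))

/-- `T` is the Schrödinger operator `H = A + Q` on `ℓ²(V)`. There is at most one such `T`. -/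
def IsSchrodingerOperator (Q : V → ℝ)
    (T : lp (fun _ : V => ℂ) 2 →L[ℂ] lp (fun _ : V => ℂ) 2) : Prop :=
  ∀ (ψ : lp (fun _ : V => ℂ) 2) (v : V), T ψ v = (∑ u ∈ Γ.nbrs v, ψ u) + (Q v : ℂ) * ψ v

end PeriodicGraph

/-- The fraction
`#{r ∈ {0, …, N-1}ᵈ : E_s((r + m) / N) = E_w(r / N)} / Nᵈ`,
for two functions `Es`, `Ew` of the quasimomentum. -/
noncomputable def coincidenceFraction {d : ℕ} (Es Ew : (Fin d → ℝ) → ℝ) (N : ℕ)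
    (m : Fin d → Fin N) : ℝ :=
  (Nat.card {r : Fin d → Fin N //
    Es (fun i => (((r i : ℕ) : ℝ) + ((m i : ℕ) : ℝ)) / N) - Ew (fun i => ((r i : ℕ) : ℝ) / N) = 0} :
      ℝ) / (N : ℝ) ^ d

/-- For all `s, w`, the supremum over nonzero `m ∈ {0, …, N-1}ᵈ` of the fraction above tends to `0`
as `N → ∞`. -/
def FloquetCondition {d : ℕ} {ι : Type} (E : ι → (Fin d → ℝ) → ℝ) : Prop :=
  ∀ s w : ι, Filter.Tendsto
    (fun N : ℕ => ⨆ m : {m : Fin d → Fin N // ∃ i, (m i : ℕ) ≠ 0},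
      coincidenceFraction (E s) (E w) N m)
    Filter.atTop (nhds 0)

/-- The Floquet assumption for the Schrödinger operator `A + Q` on a periodic graph: the Floquet
eigenvalues can be labelled so that the condition holds. (As the condition is about all pairs
`s, w`, it does not depend on the labelling.) -/
def PeriodicGraph.SatisfiesFloquetAssumption {V : Type} {G : SimpleGraph V} {d : ℕ}
    (Γ : PeriodicGraph G d) (Q : V → ℝ) : Prop :=
  ∃ E : Fin (Fintype.card Γ.crystal) → (Fin d → ℝ) → ℝ,
    Γ.IsFloquetEigenvalues Q E ∧ FloquetCondition E

/-- `μ` is the spectral measure of the self-adjoint bounded operator `T` at the vector `ψ`: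
`⟨ψ, f(T) ψ⟩ = ∫ f dμ` for all bounded continuous `f`. -/
def IsSpectralMeasure {H : Type*} [NormedAddCommGroup H] [InnerProductSpace ℂ H] [CompleteSpace H]
    (T : H →L[ℂ] H) (ψ : H) (μ : MeasureTheory.Measure ℝ) : Prop :=
  MeasureTheory.IsFiniteMeasure μ ∧
    ∀ f : ℝ →ᵇ ℝ, @inner ℂ H InnerProductSpace.toInner ψ (cfc (f : ℝ → ℝ) T ψ) = ((∫ x, f x ∂μ : ℝ) : ℂ)

/-- A bounded self-adjoint operator has purely absolutely continuous spectrum if all its spectral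
measures are absolutely continuous with respect to Lebesgue measure. -/
def IsPurelyAbsolutelyContinuous {H : Type*} [NormedAddCommGroup H] [InnerProductSpace ℂ H]
    [CompleteSpace H] (T : H →L[ℂ] H) : Prop :=
  IsSelfAdjoint T ∧ ∀ ψ : H, ∃ μ : MeasureTheory.Measure ℝ,
    IsSpectralMeasure T ψ μ ∧ MeasureTheory.Measure.AbsolutelyContinuous μ MeasureTheory.volume

/-- The Schrödinger operator `A + Q` is a well-defined bounded self-adjoint operator on `ℓ²(V)` and
has purely absolutely continuous spectrum. -/
def PeriodicGraph.HasPurelyACSpectrum {V : Type} {G : SimpleGraph V} {d : ℕ}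
    (Γ : PeriodicGraph G d) (Q : V → ℝ) : Prop :=
  ∃ T : lp (fun _ : V => ℂ) 2 →L[ℂ] lp (fun _ : V => ℂ) 2,
    Γ.IsSchrodingerOperator Q T ∧ IsPurelyAbsolutelyContinuous T

open Classical in
/-- `μ` lists the eigenvalues of the adjacency matrix of a finite graph with multiplicities. -/
def IsAdjacencySpectrum {F : Type} [Fintype F] (G : SimpleGraph F) {ι : Type} [Fintype ι]
    (μ : ι → ℝ) : Prop :=
  (G.adjMatrix ℝ).charpoly = ∏ j, (Polynomial.X - Polynomial.C (μ j))

/-- The finite graph `C₃ □ P₄`. -/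
def cycleBoxPath : SimpleGraph (Fin 3 × Fin 4) :=
  SimpleGraph.boxProd (SimpleGraph.cycleGraph 3) (SimpleGraph.pathGraph 4)

/-- The graph `ℤ × (C₃ □ P₄)` (tensor product), where `ℤ` is the two-sided infinite path. -/
noncomputable def counterexampleGraph : SimpleGraph (ℤ × (Fin 3 × Fin 4)) :=
  SimpleGraph.tensorProduct (SimpleGraph.hasse ℤ) cycleBoxPath

/-!
The adjacency operator of the tensor product of the two-sided infinite path with a finite graph `K`
is the tensor product of the two adjacency operators. Fourier series diagonalize the first factor
into multiplication by `2 cos (2 π t)` on the circle, the spectral theorem diagonalizes the second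
into its eigenvalues `μ j`. So the operator becomes multiplication by `2 μ j cos (2 π t)` on one circle
for each `j`, and `θ ↦ 2 μ j cos (2 π θ)` are the Floquet eigenvalues.

*Absolute continuity* needs only that every `μ j` is nonzero. The spectral measure at `ψ` is then the
image of an absolutely continuous measure on the circles under `2 μ j cos (2 π t)`, and preimages
of null sets under the cosine are null because `arccos` maps null sets to null sets
(`IsSelfAdjoint.isPurelyAbsolutelyContinuous_of_intertwining`, `Real.quasiMeasurePreserving_cos`).
The operator itself is obtained by compressing the multiplication operator to the closed span of an
orthonormal family on which it acts as the adjacency relation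
(`exists_isSelfAdjoint_intertwining_of_orthonormal`).

*The Floquet assumption* fails if both `μ` and `-μ` are eigenvalues of `K`: then one Floquet eigenvalue
is the translate of another by half a period, so that for even `N` and `m = N / 2` all `r` are
coincidences. As the labelling of the eigenvalues may change with `θ`, the coincidences are shared
out among the pairs of labels, but their fractions still add up to at least `1`
(`PeriodicGraph.not_satisfiesFloquetAssumption_of_half_period`).

For `K = C₃ □ P₄` the eigenvalues `±(3 + √5) / 2` arise as `2 + (√5 - 1) / 2` and
`-1 - (√5 + 1) / 2`, sums of an eigenvalue of `C₃` and one of `P₄`, and `0` is not an eigenvalue. The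
triangles of `C₃` make the tensor product connected.
-/

/-! ### Functions under which preimages of null sets are null -/

open MeasureTheory in
theorem Real.volume_image_arccos_eq_zero {N : Set ℝ} (hN : volume N = 0) :
    volume (Real.arccos '' N) = 0 := by
  have h1 : volume (Real.arccos '' (N ∩ Set.Ioo (-1) 1)) = 0 := by
    apply addHaar_image_eq_zero_of_differentiableOn_of_addHaar_eq_zero
    · intro x hx
      exact (Real.differentiableAt_arccos.2
        ⟨hx.2.1.ne', hx.2.2.ne⟩).differentiableWithinAt
    · exact measure_mono_null Set.inter_subset_left hN
  -- outside `(-1, 1)`, where `arccos` is not differentiable, it has only the values `0` and `π`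
  refine measure_mono_null (t := Real.arccos '' (N ∩ Set.Ioo (-1) 1) ∪ {0, Real.pi}) ?_
    (measure_union_null h1 (Set.Finite.measure_zero (Set.toFinite _) _))
  rintro _ ⟨x, hx, rfl⟩
  by_cases h : -1 < x ∧ x < 1
  · exact Or.inl ⟨x, ⟨hx, h⟩, rfl⟩
  · right
    rcases not_and_or.1 h with h | h
    · exact Or.inr (Real.arccos_of_le_neg_one (not_lt.1 h))
    · exact Or.inl (Real.arccos_of_one_le (not_lt.1 h))

open MeasureTheory in
/-- `cos t ∈ N` means that `t = 2 k π ± s` with `s ∈ arccos '' N`. -/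
theorem Real.quasiMeasurePreserving_cos :
    Measure.QuasiMeasurePreserving Real.cos volume volume := by
  refine ⟨Real.measurable_cos, Measure.AbsolutelyContinuous.mk fun N hN h0 => ?_⟩
  rw [Measure.map_apply Real.measurable_cos hN]
  have hA := Real.volume_image_arccos_eq_zero h0
  set A := Real.arccos '' N
  refine measure_mono_null
    (t := ⋃ k : ℤ, ((fun t => -(2 * k * Real.pi) + t) ⁻¹' A ∪
      (fun t => 2 * k * Real.pi - t) ⁻¹' A)) ?_
    (measure_iUnion_null fun k => measure_union_null ?_ ?_)
  · intro t ht
    have h : Real.cos (Real.arccos (Real.cos t)) = Real.cos t :=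
      Real.cos_arccos (Real.neg_one_le_cos t) (Real.cos_le_one t)
    obtain ⟨k, hk | hk⟩ := Real.cos_eq_cos_iff.1 h
    · refine Set.mem_iUnion.2 ⟨k, Or.inl ⟨_, ht, ?_⟩⟩
      linarith
    · refine Set.mem_iUnion.2 ⟨k, Or.inr ⟨_, ht, ?_⟩⟩
      linarith
  · rw [measure_preimage_add]
    exact hA
  · exact (quasiMeasurePreserving_sub_left volume (2 * k * Real.pi)).preimage_null hA

open MeasureTheory in
theorem Real.quasiMeasurePreserving_mul_left {c : ℝ} (hc : c ≠ 0) :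
    Measure.QuasiMeasurePreserving (fun t : ℝ => c * t) volume volume := by
  refine ⟨by fun_prop, ?_⟩
  rw [Real.map_volume_mul_left hc]
  exact Measure.smul_absolutelyContinuous

/-! ### Operators equivalent to multiplication operators -/

open MeasureTheory in
/-- If an isometry into some `L²(ν)` carries the bounded self-adjoint operator `T` to multiplication
by `h`, and `h` maps `ν` to an absolutely continuous measure, then `T` has purely absolutely
continuous spectrum: the spectral measure at `ψ` is the image under `h` of `|U ψ|² ν`. The isometry
need not be surjective. -/
theorem IsSelfAdjoint.isPurelyAbsolutelyContinuous_of_intertwining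
    {H : Type*} [NormedAddCommGroup H] [InnerProductSpace ℂ H] [CompleteSpace H]
    {X : Type*} [MeasurableSpace X] {ν : Measure X}
    {T : H →L[ℂ] H} (hT : IsSelfAdjoint T) (U : H →ₗᵢ[ℂ] Lp ℂ 2 ν) {h : X → ℝ} {C : ℝ}
    (hq : Measure.QuasiMeasurePreserving h ν volume) (hC : ∀ x, |h x| ≤ C)
    (hU : ∀ ψ, U (T ψ) =ᵐ[ν] fun x => (h x : ℂ) * U ψ x) :
    IsPurelyAbsolutelyContinuous T := by
  refine ⟨hT, fun ψ => ?_⟩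
  have hint : Integrable (fun x => ‖U ψ x‖ ^ 2) ν := (Lp.memLp (U ψ)).integrable_norm_pow two_ne_zero
  have hsm : StronglyMeasurable (U ψ) := Lp.stronglyMeasurable (U ψ)
  set w : X → NNReal := fun x => ‖U ψ x‖₊ ^ 2 with hw
  have hwm : Measurable w := (hsm.measurable.nnnorm).pow_const 2
  set ρ : Measure X := ν.withDensity (fun x => (w x : ENNReal)) with hρ
  have hρfin : IsFiniteMeasure ρ := by
    apply isFiniteMeasure_withDensity
    have := hint.hasFiniteIntegral
    rw [hasFiniteIntegral_iff_enorm] at this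
    convert this.ne using 3 with x
    rw [hw]
    rw [← ofReal_norm, norm_pow, norm_norm, ENNReal.ofReal_pow (norm_nonneg _),
      ofReal_norm]
    simp [enorm]
  -- the polynomial functional calculus becomes multiplication by `p ∘ h`
  have hpoly : ∀ (p : Polynomial ℝ),
      U (Polynomial.aeval T p ψ) =ᵐ[ν] fun x => ((p.eval (h x) : ℝ) : ℂ) * U ψ x := by
    intro p
    induction p using Polynomial.induction_on with
    | C a =>
      have : U (Polynomial.aeval T (Polynomial.C a) ψ) = (a : ℂ) • U ψ := by
        rw [Polynomial.aeval_C, ← map_smul]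
        congr 1
      rw [this]
      filter_upwards [Lp.coeFn_smul (a : ℂ) (U ψ)] with x hx
      rw [hx]; simp
    | add p q hp hq =>
      rw [map_add, add_apply, map_add]
      filter_upwards [hp, hq, Lp.coeFn_add (U (Polynomial.aeval T p ψ)) (U (Polynomial.aeval T q ψ))]
        with x h1 h2 h3
      rw [h3, Pi.add_apply, h1, h2]
      push_cast [Polynomial.eval_add]
      ring
    | monomial n a ih =>
      have : Polynomial.aeval T (Polynomial.C a * Polynomial.X ^ (n + 1)) ψ =
          T (Polynomial.aeval T (Polynomial.C a * Polynomial.X ^ n) ψ) := by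
        rw [pow_succ, ← mul_assoc, mul_comm, map_mul, Polynomial.aeval_X]; rfl
      rw [this]
      filter_upwards [ih, hU (Polynomial.aeval T (Polynomial.C a * Polynomial.X ^ n) ψ)] with x h1 h2
      rw [h2, h1]
      simp only [Polynomial.eval_mul, Polynomial.eval_C, Polynomial.eval_pow, Polynomial.eval_X]
      push_cast
      ring
  have hmap : ∀ f : ℝ → ℝ, Continuous f →
      ∫ y, f y ∂(ρ.map h) = ∫ x, f (h x) ∂ρ := fun f hf =>
    integral_map hq.measurable.aemeasurable hf.aestronglyMeasurable
  have hinner : ∀ p : Polynomial ℝ, (inner ℂ ψ (Polynomial.aeval T p ψ) : ℂ) =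
      ((∫ x, p.eval (h x) ∂ρ : ℝ) : ℂ) := by
    intro p
    rw [← U.inner_map_map, L2.inner_def, hρ, integral_withDensity_eq_integral_smul hwm,
      ← integral_complex_ofReal]
    refine integral_congr_ae ?_
    filter_upwards [hpoly p] with x hx
    rw [hx, RCLike.inner_apply, mul_assoc, Complex.mul_conj, Complex.normSq_eq_norm_sq, hw,
      NNReal.smul_def]
    push_cast
    simp [mul_comm]
  refine ⟨ρ.map h, ⟨Measure.isFiniteMeasure_map ρ h, fun f => ?_⟩, ?_⟩
  · -- approximate `f` by polynomials, uniformly on an interval that contains the spectrum of `T`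
    -- and the values of `h`
    rw [hmap f f.continuous]
    set R := max C ‖T‖
    have hfc : ContinuousOn (f : ℝ → ℝ) (spectrum ℝ T) := f.continuous.continuousOn
    have hspec : ∀ x ∈ spectrum ℝ T, x ∈ Set.Icc (-R) R := by
      intro x hx
      have h1 : ‖x‖ ≤ ‖T‖ := by
        by_cases hH : Nontrivial H
        · exact spectrum.norm_le_norm_of_mem hx
        · rw [not_nontrivial_iff_subsingleton] at hH
          have : Subsingleton (H →L[ℂ] H) := inferInstance
          rw [spectrum.of_subsingleton] at hx
          exact hx.elim
      exact abs_le.1 (h1.trans (le_max_right _ _))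
    have key : ∀ ε > 0, ‖(inner ℂ ψ (cfc (f : ℝ → ℝ) T ψ) : ℂ) - ((∫ x, f (h x) ∂ρ : ℝ) : ℂ)‖ ≤
        ε * (‖ψ‖ * ‖ψ‖ + ρ.real Set.univ) := by
      intro ε hε
      obtain ⟨p, hp⟩ := exists_polynomial_near_of_continuousOn (-R) R f f.continuous.continuousOn ε hε
      have hpc : ContinuousOn (fun x => p.eval x) (spectrum ℝ T) := p.continuous.continuousOn
      have h1 : ‖cfc (f : ℝ → ℝ) T - Polynomial.aeval T p‖ ≤ ε := by
        rw [← cfc_polynomial p T hT, ← cfc_sub _ _ T hfc hpc]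
        refine norm_cfc_le hε.le fun x hx => ?_
        rw [← norm_neg, neg_sub]
        exact (hp x (hspec x hx)).le
      have hb : ∀ x, |p.eval (h x) - f (h x)| < ε := fun x =>
        hp _ (abs_le.1 ((hC x).trans (le_max_left _ _)))
      have hif : Integrable (fun x => f (h x)) ρ :=
        Integrable.of_bound ((f.continuous.measurable.comp hq.measurable).aestronglyMeasurable) ‖f‖
          (Filter.Eventually.of_forall fun x => f.norm_coe_le_norm _)
      have hid : Integrable (fun x => p.eval (h x) - f (h x)) ρ :=
        Integrable.of_bound ((p.continuous.sub f.continuous).measurable.comp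
          hq.measurable).aestronglyMeasurable ε (Filter.Eventually.of_forall fun x => (hb x).le)
      have h2 : ‖∫ x, (p.eval (h x) - f (h x)) ∂ρ‖ ≤ ε * ρ.real Set.univ :=
        norm_integral_le_of_norm_le_const (Filter.Eventually.of_forall fun x => (hb x).le)
      have h3 : ∫ x, p.eval (h x) ∂ρ = ∫ x, f (h x) ∂ρ + ∫ x, (p.eval (h x) - f (h x)) ∂ρ := by
        rw [← integral_add hif hid]
        simp
      have h4 : (inner ℂ ψ (cfc (f : ℝ → ℝ) T ψ) : ℂ) - ((∫ x, f (h x) ∂ρ : ℝ) : ℂ) =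
          inner ℂ ψ ((cfc (f : ℝ → ℝ) T - Polynomial.aeval T p) ψ) +
            ((∫ x, (p.eval (h x) - f (h x)) ∂ρ : ℝ) : ℂ) := by
        rw [sub_apply, inner_sub_right, hinner p, h3]
        push_cast
        ring
      rw [h4, mul_add]
      refine (norm_add_le _ _).trans (add_le_add ?_ ?_)
      · refine (norm_inner_le_norm _ _).trans ?_
        have := (cfc (f : ℝ → ℝ) T - Polynomial.aeval T p).le_of_opNorm_le h1 ψ
        nlinarith [norm_nonneg ψ]
      · rwa [Complex.norm_real]
    rw [← sub_eq_zero, ← norm_le_zero_iff]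
    set K := ‖ψ‖ * ‖ψ‖ + ρ.real Set.univ with hK
    have hK0 : 0 ≤ K := by positivity
    refine le_of_forall_pos_le_add fun δ hδ => ?_
    refine (key (δ / (K + 1)) (by positivity)).trans ?_
    rw [zero_add, div_mul_eq_mul_div, div_le_iff₀ (by positivity)]
    nlinarith
  · exact ((withDensity_absolutelyContinuous ν _).map hq.measurable).trans hq.absolutelyContinuous

open MeasureTheory in
/-- Multiplication by a bounded real function is a self-adjoint operator on `L²`. -/
theorem MeasureTheory.Lp.exists_isSelfAdjoint_coeFn_eq_mul {X : Type*} [MeasurableSpace X]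
    (ν : Measure X) {h : X → ℝ} (hm : Measurable h) {C : ℝ} (hC : ∀ x, |h x| ≤ C) :
    ∃ M : Lp ℂ 2 ν →L[ℂ] Lp ℂ 2 ν, IsSelfAdjoint M ∧
      ∀ g : Lp ℂ 2 ν, M g =ᵐ[ν] fun x => (h x : ℂ) * g x := by
  have hL : MemLp (fun x => (h x : ℂ)) ⊤ ν :=
    memLp_top_of_bound (Complex.measurable_ofReal.comp hm).aestronglyMeasurable C
      (Filter.Eventually.of_forall fun x => by rw [Complex.norm_real]; exact hC x)
  set M : Lp ℂ 2 ν →L[ℂ] Lp ℂ 2 ν :=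
    (ContinuousLinearMap.mul ℂ ℂ).holderL ν ⊤ 2 2 (hL.toLp _) with hM
  have hMg : ∀ g : Lp ℂ 2 ν, M g =ᵐ[ν] fun x => (h x : ℂ) * g x := by
    intro g
    have h1 := (ContinuousLinearMap.mul ℂ ℂ).coeFn_holder (r := 2) (hL.toLp _) g
    filter_upwards [h1, hL.coeFn_toLp] with x hx1 hx2
    rw [← hx2]
    exact hx1
  refine ⟨M, ?_, hMg⟩
  rw [ContinuousLinearMap.isSelfAdjoint_iff_isSymmetric]
  intro f g
  rw [ContinuousLinearMap.coe_coe, L2.inner_def, L2.inner_def]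
  refine integral_congr_ae ?_
  filter_upwards [hMg f, hMg g] with x h1 h2
  rw [h1, h2, RCLike.inner_apply, RCLike.inner_apply, map_mul, Complex.conj_ofReal]
  ring

/-- Two bounded operators on `ℓ²` agree if they agree on the standard basis vectors. -/
theorem lp.continuousLinearMap_ext_single {V : Type*} [DecidableEq V] {E : Type*}
    [NormedAddCommGroup E] [NormedSpace ℂ E] {S T : lp (fun _ : V => ℂ) 2 →L[ℂ] E}
    (h : ∀ v, S (lp.single 2 v 1) = T (lp.single 2 v 1)) : S = T := by
  ext ψ
  have hs := lp.hasSum_single (E := fun _ : V => ℂ) (p := 2) (by simp) ψ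
  refine (hs.mapL S).unique ?_
  convert hs.mapL T using 2 with v
  have : lp.single (E := fun _ : V => ℂ) 2 v (ψ v) = ψ v • lp.single 2 v 1 := by
    rw [← lp.single_smul, smul_eq_mul, mul_one]
  rw [this, map_smul, map_smul, h v]

open MeasureTheory in
/-- Suppose that multiplication by the bounded real function `h` maps each `e v` of an orthonormal
family in `L²(ν)` to the sum of the `e u` over the `u ∈ N v`. Then the adjacency operator of the
relation `u ∈ N v` is unitarily equivalent to the restriction of this multiplication operator to an
invariant subspace. -/
theorem exists_isSelfAdjoint_intertwining_of_orthonormal {V X : Type*} [MeasurableSpace X]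
    {ν : Measure X} {h : X → ℝ} (hm : Measurable h) {C : ℝ} (hC : ∀ x, |h x| ≤ C)
    {e : V → Lp ℂ 2 ν} (he : Orthonormal ℂ e) (N : V → Finset V)
    (hN : ∀ v, (fun x => (h x : ℂ) * e v x) =ᵐ[ν] (∑ u ∈ N v, e u : Lp ℂ 2 ν)) :
    ∃ (T : lp (fun _ : V => ℂ) 2 →L[ℂ] lp (fun _ : V => ℂ) 2)
      (U : lp (fun _ : V => ℂ) 2 →ₗᵢ[ℂ] Lp ℂ 2 ν), IsSelfAdjoint T ∧
      (∀ ψ v, T ψ v = ∑ u ∈ N v, ψ u) ∧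
      ∀ ψ, U (T ψ) =ᵐ[ν] fun x => (h x : ℂ) * U ψ x := by
  classical
  obtain ⟨M, hMs, hM⟩ := Lp.exists_isSelfAdjoint_coeFn_eq_mul ν hm hC
  have hMe : ∀ v, M (e v) = ∑ u ∈ N v, e u := fun v => Lp.ext ((hM _).trans (hN v))
  set U : lp (fun _ : V => ℂ) 2 →ₗᵢ[ℂ] Lp ℂ 2 ν := he.orthogonalFamily.linearIsometry
  have hUe : ∀ v, U (lp.single 2 v 1) = e v := fun v => by
    rw [OrthogonalFamily.linearIsometry_apply_single]
    simp
  set U' := U.toContinuousLinearMap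
  set T := (ContinuousLinearMap.adjoint U') ∘L M ∘L U'
  -- an isometry has its adjoint as a left inverse
  have hUU : ∀ ψ, ContinuousLinearMap.adjoint U' (U ψ) = ψ := fun ψ => by
    refine ext_inner_left ℂ fun φ => ?_
    rw [ContinuousLinearMap.adjoint_inner_right]
    exact U.inner_map_map φ ψ
  have hTe : ∀ v, T (lp.single 2 v 1) = ∑ u ∈ N v, lp.single 2 u 1 := fun v => by
    change ContinuousLinearMap.adjoint U' (M (U (lp.single 2 v 1))) = _
    rw [hUe, hMe, map_sum]
    exact Finset.sum_congr rfl fun u _ => by rw [← hUe u, hUU]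
  have hTs : IsSelfAdjoint T := by
    rw [ContinuousLinearMap.isSelfAdjoint_iff'] at hMs ⊢
    simp only [T, ContinuousLinearMap.adjoint_comp, ContinuousLinearMap.adjoint_adjoint, hMs]
    rfl
  refine ⟨T, U, hTs, fun ψ v => ?_, fun ψ => ?_⟩
  · have h1 : ∀ (φ : lp (fun _ : V => ℂ) 2) v, φ v = inner ℂ (lp.single 2 v 1) φ := fun φ v => by
      rw [lp.inner_single_left]
      simp
    rw [h1, ← ContinuousLinearMap.adjoint_inner_left,
      (ContinuousLinearMap.isSelfAdjoint_iff' (A := T)).1 hTs, hTe, sum_inner]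
    exact Finset.sum_congr rfl fun u _ => (h1 ψ u).symm
  · have h2 : U' ∘L T = M ∘L U' := lp.continuousLinearMap_ext_single fun v => by
      change U (T _) = M (U _)
      rw [hTe, hUe, hMe, map_sum]
      exact Finset.sum_congr rfl fun u _ => hUe u
    have h3 : U (T ψ) = M (U ψ) := congrArg (fun S => S ψ) h2
    rw [h3]
    exact hM _

/-! ### Neighbours in the tensor product with the infinite path -/

theorem SimpleGraph.hasse_int_adj {m n : ℤ} :
    (SimpleGraph.hasse ℤ).Adj m n ↔ n = m + 1 ∨ n = m - 1 := by
  rw [SimpleGraph.hasse_adj, Order.covBy_iff_add_one_eq, Order.covBy_iff_add_one_eq]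
  omega

theorem SimpleGraph.tensorProduct_adj {α β : Type*} {G : SimpleGraph α} {H : SimpleGraph β}
    {x y : α × β} : (G.tensorProduct H).Adj x y ↔ G.Adj x.1 y.1 ∧ H.Adj x.2 y.2 := Iff.rfl

/-- Sums over the neighbours of a vertex of the tensor product of the two-sided infinite path with a
finite graph. -/
theorem SimpleGraph.sum_tensorProduct_hasse_int {F M : Type*} [Fintype F] [AddCommMonoid M]
    {K : SimpleGraph F} [DecidableRel K.Adj] {n : ℤ} {x : F} {N : Finset (ℤ × F)}
    (hN : ∀ u, u ∈ N ↔ ((SimpleGraph.hasse ℤ).tensorProduct K).Adj (n, x) u) (f : ℤ × F → M) :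
    ∑ u ∈ N, f u = ∑ y, if K.Adj x y then f (n + 1, y) + f (n - 1, y) else 0 := by
  classical
  have : N = ({n + 1, n - 1} : Finset ℤ) ×ˢ Finset.univ.filter (K.Adj x) := by
    ext ⟨m, y⟩
    rw [hN, tensorProduct_adj, hasse_int_adj]
    simp
  rw [this, Finset.sum_product_right, Finset.sum_filter]
  refine Finset.sum_congr rfl fun y _ => ?_
  rw [Finset.sum_pair (by omega)]

/-! ### The Fourier transform of the adjacency operator -/

open MeasureTheory in
theorem quasiMeasurePreserving_fourier_one_re {c : ℝ} (hc : c ≠ 0) :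
    Measure.QuasiMeasurePreserving (fun t : UnitAddCircle => c * (fourier 1 t).re)
      AddCircle.haarAddCircle volume := by
  have hm : Measurable (fun t : UnitAddCircle => c * (fourier 1 t).re) :=
    ((Complex.continuous_re.comp (fourier 1).continuous).const_mul _).measurable
  refine ⟨hm, Measure.AbsolutelyContinuous.mk fun N hN h0 => ?_⟩
  have hv : (AddCircle.haarAddCircle : Measure UnitAddCircle) = volume := by
    rw [AddCircle.volume_eq_smul_haarAddCircle, ENNReal.ofReal_one, one_smul]
  rw [Measure.map_apply hm hN, hv,
    ← (AddCircle.measurePreserving_mk 1 0).measure_preimage (hm hN).nullMeasurableSet]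
  refine Measure.absolutelyContinuous_of_le Measure.restrict_le_self ?_
  have hq := ((Real.quasiMeasurePreserving_mul_left hc).comp Real.quasiMeasurePreserving_cos).comp
    (Real.quasiMeasurePreserving_mul_left (c := 2 * Real.pi) (by positivity))
  refine Eq.trans (congrArg _ ?_) (hq.preimage_null h0)
  ext t
  have : (fourier 1 (t : UnitAddCircle)).re = Real.cos (2 * Real.pi * t) := by
    rw [fourier_coe_apply, ← Complex.exp_ofReal_mul_I_re]
    congr 2
    push_cast
    ring
  simp only [Set.mem_preimage, Function.comp_apply]
  rw [← this]

/-- The Fourier transform on `ℤ` and the diagonalization `O` of the adjacency matrix of `K`, with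
nonzero eigenvalues `μ j`, turn the adjacency operator of the tensor product of the two-sided
infinite path with `K` into multiplication by `2 μ j cos (2 π t)` on the union of the circles
`{j} × (ℝ ⧸ ℤ)`. -/
theorem exists_isPurelyAbsolutelyContinuous_tensorProduct_hasse_int {F : Type*} [Fintype F]
    [DecidableEq F] {K : SimpleGraph F} [DecidableRel K.Adj] {k : ℕ} {μ : Fin k → ℝ}
    (hμ : ∀ j, μ j ≠ 0) {O : F → Fin k → ℝ}
    (hO : ∀ x y, ∑ j, O x j * O y j = if x = y then 1 else 0)
    (hK : ∀ x j, (∑ y, if K.Adj x y then O y j else 0) = μ j * O x j)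
    {N : ℤ × F → Finset (ℤ × F)}
    (hN : ∀ v u, u ∈ N v ↔ ((SimpleGraph.hasse ℤ).tensorProduct K).Adj v u) :
    ∃ T : lp (fun _ : ℤ × F => ℂ) 2 →L[ℂ] lp (fun _ : ℤ × F => ℂ) 2,
      (∀ ψ v, T ψ v = ∑ u ∈ N v, ψ u) ∧ IsPurelyAbsolutelyContinuous T := by
  open MeasureTheory in
  set ν : Measure (Fin k × UnitAddCircle) := Measure.count.prod AddCircle.haarAddCircle with hν
  set h : Fin k × UnitAddCircle → ℝ := fun p => 2 * μ p.1 * (fourier 1 p.2).re with hh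
  have hm : Measurable h :=
    measurable_from_prod_countable_right fun j => (quasiMeasurePreserving_fourier_one_re
      (mul_ne_zero two_ne_zero (hμ j))).measurable
  have hq : Measure.QuasiMeasurePreserving h ν volume := by
    refine ⟨hm, Measure.AbsolutelyContinuous.mk fun S hS h0 => ?_⟩
    rw [Measure.map_apply hm hS, Measure.measure_prod_null (hm hS)]
    exact Filter.Eventually.of_forall fun j => (quasiMeasurePreserving_fourier_one_re
      (mul_ne_zero two_ne_zero (hμ j))).preimage_null h0
  have hC : ∀ p, |h p| ≤ ∑ j, |2 * μ j| := by
    intro p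
    rw [hh, abs_mul]
    have h1 : |(fourier 1 p.2).re| ≤ 1 :=
      (Complex.abs_re_le_norm _).trans (by rw [fourier_apply, Circle.norm_coe])
    calc |2 * μ p.1| * |(fourier 1 p.2).re| ≤ |2 * μ p.1| := mul_le_of_le_one_right (abs_nonneg _) h1
      _ ≤ _ := Finset.single_le_sum (f := fun j => |2 * μ j|) (fun j _ => abs_nonneg _)
        (Finset.mem_univ p.1)
  set g : ℤ × F → C(Fin k × UnitAddCircle, ℂ) := fun v =>
    ⟨fun p => (O v.2 p.1 : ℂ) * fourier v.1 p.2, by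
      refine Continuous.mul ?_ ((fourier v.1).continuous.comp continuous_snd)
      exact (continuous_of_discreteTopology (f := fun j => (O v.2 j : ℂ))).comp continuous_fst⟩
    with hg
  have hgv : ∀ v p, g v p = (O v.2 p.1 : ℂ) * fourier v.1 p.2 := fun _ _ => rfl
  set e : ℤ × F → Lp ℂ 2 ν := fun v => ContinuousMap.toLp 2 ν ℂ (g v) with he
  have hfour : ∀ m n : ℤ, ∫ t : UnitAddCircle, fourier n t * (starRingEnd ℂ) (fourier m t)
      ∂AddCircle.haarAddCircle = if m = n then 1 else 0 := by
    intro m n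
    rw [← orthonormal_iff_ite.1 (orthonormal_fourier (T := 1)) m n, ContinuousMap.inner_toLp]
  -- the family is orthonormal as the characters and the rows of `O` are
  have hon : Orthonormal ℂ e := by
    rw [orthonormal_iff_ite]
    rintro ⟨m, x⟩ ⟨n, y⟩
    rw [he, ContinuousMap.inner_toLp, hν, integral_prod, integral_count]
    · have : ∀ j, ∫ t, g (n, y) (j, t) * (starRingEnd ℂ) (g (m, x) (j, t))
          ∂AddCircle.haarAddCircle = ((O x j * O y j : ℝ) : ℂ) * if m = n then 1 else 0 := by
        intro j
        rw [← hfour, ← integral_const_mul]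
        refine integral_congr_ae (Filter.Eventually.of_forall fun t => ?_)
        simp only [hgv, map_mul, Complex.conj_ofReal]
        push_cast
        ring
      rw [Finset.sum_congr rfl fun j _ => this j, ← Finset.sum_mul, ← Complex.ofReal_sum, hO]
      by_cases h1 : x = y <;> by_cases h2 : m = n <;> simp [h1, h2]
    · exact ((g (n, y) * star (g (m, x))).continuous.integrable_of_hasCompactSupport
        (HasCompactSupport.of_compactSpace _))
  -- `2 cos (2 π t)` is the sum of the characters `1` and `-1`, so multiplication by it adds up the two
  -- shifts, while `μ j` sums the `j`-th eigenvector over the neighbours in `K`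
  have hadj : ∀ v p, (h p : ℂ) * g v p = (∑ u ∈ N v, g u) p := by
    rintro ⟨n, x⟩ ⟨j, t⟩
    rw [ContinuousMap.sum_apply, SimpleGraph.sum_tensorProduct_hasse_int (hN (n, x))
      fun u => g u (j, t)]
    have h1 : ((2 * (fourier 1 t).re : ℝ) : ℂ) = fourier 1 t + fourier (-1) t := by
      rw [fourier_neg, Complex.add_conj]
    have h2 : ((h (j, t) : ℝ) : ℂ) * g (n, x) (j, t) =
        ((μ j * O x j : ℝ) : ℂ) * (fourier (n + 1) t + fourier (n - 1) t) := by
      rw [sub_eq_add_neg, fourier_add, fourier_add, ← mul_add, ← h1, hgv, hh]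
      push_cast
      ring
    rw [h2, ← hK, Complex.ofReal_sum, Finset.sum_mul]
    refine Finset.sum_congr rfl fun y _ => ?_
    split_ifs
    · simp only [hgv]
      ring
    · simp
  obtain ⟨T, U, hT, hTN, hU⟩ := exists_isSelfAdjoint_intertwining_of_orthonormal hm hC hon N
    fun v => by
      rw [he, ← map_sum]
      filter_upwards [ContinuousMap.coeFn_toLp (p := 2) ν (𝕜 := ℂ) (g v),
        ContinuousMap.coeFn_toLp (p := 2) ν (𝕜 := ℂ) (∑ u ∈ N v, g u)] with p h1 h2
      rw [h1, h2, hadj]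
  exact ⟨T, hTN, hT.isPurelyAbsolutelyContinuous_of_intertwining U hq hC hU⟩

/-! ### Violation of the Floquet assumption -/

/-- If one Floquet eigenvalue is the translate of another by the half period `(1/2, …, 1/2)`, then
the Floquet assumption fails: for even `N` and `m = (N/2, …, N/2)`, every `r` is a coincidence for
some pair of labels. -/
theorem PeriodicGraph.not_satisfiesFloquetAssumption_of_half_period {V : Type} {G : SimpleGraph V}
    {d : ℕ} (hd : 0 < d) {Γ : PeriodicGraph G d} {Q : V → ℝ} {ι : Type} [Fintype ι]
    {E₀ : ι → (Fin d → ℝ) → ℝ} (hE₀ : Γ.IsFloquetEigenvalues Q E₀) {j k : ι}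
    (hjk : ∀ θ : Fin d → ℝ, E₀ j (fun i => θ i + 1 / 2) = E₀ k θ) :
    ¬ Γ.SatisfiesFloquetAssumption Q := by
  rintro ⟨E, hE, hF⟩
  have hex : ∀ i θ, ∃ s, E s θ = E₀ i θ := by
    intro i θ
    have h := congrArg (Polynomial.eval (E₀ i θ : ℂ)) ((hE θ).symm.trans (hE₀ θ))
    rw [Polynomial.eval_prod, Polynomial.eval_prod,
      Finset.prod_eq_zero (Finset.mem_univ i) (by simp), Finset.prod_eq_zero_iff] at h
    obtain ⟨s, -, hs⟩ := h
    refine ⟨s, ?_⟩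
    rw [Polynomial.eval_sub, Polynomial.eval_X, Polynomial.eval_C, sub_eq_zero] at hs
    exact_mod_cast hs.symm
  -- the sum over all pairs of labels of the suprema tends to `0` along the even `N`
  have hlim := (tendsto_finsetSum Finset.univ fun s _ =>
    tendsto_finsetSum Finset.univ fun w _ => hF s w).comp
      (Filter.tendsto_id.const_mul_atTop' (r := 2) two_pos)
  simp only [Finset.sum_const_zero] at hlim
  refine absurd (ge_of_tendsto hlim ?_) (not_le.2 (zero_lt_one' ℝ))
  filter_upwards [Filter.eventually_ge_atTop 1] with n hn
  set N := 2 * n with hNdef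
  change 1 ≤ ∑ s, ∑ w, ⨆ m : {m : Fin d → Fin N // ∃ i, (m i : ℕ) ≠ 0},
    coincidenceFraction (E s) (E w) N m
  let m : {m : Fin d → Fin N // ∃ i, (m i : ℕ) ≠ 0} :=
    ⟨fun _ => ⟨n, by omega⟩, ⟨0, hd⟩, by simpa using by omega⟩
  refine le_trans ?_ (Finset.sum_le_sum fun s _ => Finset.sum_le_sum fun w _ =>
    le_ciSup (f := fun m : {m : Fin d → Fin N // ∃ i, (m i : ℕ) ≠ 0} =>
      coincidenceFraction (E s) (E w) N m) (Set.finite_range _).bddAbove m)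
  have hn0 : (n : ℝ) ≠ 0 := by positivity
  have hN0 : (0 : ℝ) < (N : ℝ) ^ d := by positivity
  simp only [coincidenceFraction]
  simp_rw [← Finset.sum_div]
  rw [le_div_iff₀ hN0, one_mul]
  classical
  -- every `r` is counted for some pair `(s, w)`
  have hcov : (Finset.univ : Finset (Fin d → Fin N)) ⊆ Finset.univ.biUnion fun s =>
      Finset.univ.biUnion fun w => Finset.univ.filter fun r : Fin d → Fin N =>
        E s (fun i => (((r i : ℕ) : ℝ) + ((m.1 i : ℕ) : ℝ)) / N) -
          E w (fun i => ((r i : ℕ) : ℝ) / N) = 0 := by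
    intro r _
    simp only [Finset.mem_biUnion, Finset.mem_univ, Finset.mem_filter, true_and]
    obtain ⟨s, hs⟩ := hex j (fun i => (((r i : ℕ) : ℝ) + ((m.1 i : ℕ) : ℝ)) / N)
    obtain ⟨w, hw⟩ := hex k (fun i => ((r i : ℕ) : ℝ) / N)
    refine ⟨s, w, ?_⟩
    rw [hs, hw, ← hjk, sub_eq_zero]
    congr 1
    ext i
    change (((r i : ℕ) : ℝ) + (n : ℝ)) / N = _
    have hNn : (N : ℝ) = 2 * n := by rw [hNdef]; push_cast; ring
    rw [hNn]
    field_simp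
  have hcard := (Finset.card_le_card hcov).trans (Finset.card_biUnion_le.trans
    (Finset.sum_le_sum fun s _ => Finset.card_biUnion_le))
  rw [Finset.card_univ, Fintype.card_fun, Fintype.card_fin, Fintype.card_fin] at hcard
  have hcard' := (Nat.cast_le (α := ℝ)).2 hcard
  push_cast at hcard'
  refine hcard'.trans (le_of_eq ?_)
  refine Finset.sum_congr rfl fun s _ => Finset.sum_congr rfl fun w _ => ?_
  rw [Nat.card_eq_fintype_card, Fintype.card_subtype]

/-! ### Diagonalization of adjacency matrices -/

/-- The spectral theorem for the adjacency matrix, in coordinates: `O x j` is the value at `x` of the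
`j`-th vector of an orthonormal eigenbasis. The scalar `c` provides the characteristic polynomial of
the Floquet matrix, for which `c = 2 cos (2 π θ)`. -/
theorem SimpleGraph.exists_orthonormal_eigenbasis {F : Type*} [Fintype F] [DecidableEq F]
    (K : SimpleGraph F) [DecidableRel K.Adj] {k : ℕ} (e : Fin k ≃ F) :
    ∃ (μ : Fin k → ℝ) (O : F → Fin k → ℝ),
      (∀ x y, ∑ j, O x j * O y j = if x = y then 1 else 0) ∧
      (∀ x j, (∑ y, if K.Adj x y then O y j else 0) = μ j * O x j) ∧
      ∀ c : ℝ, (c • K.adjMatrix ℝ).charpoly =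
        ∏ j, (Polynomial.X - Polynomial.C (c * μ j)) := by
  have hA := K.isHermitian_adjMatrix ℝ
  refine ⟨hA.eigenvalues ∘ e, fun x j => hA.eigenvectorBasis (e j) x, fun x y => ?_, fun x j => ?_,
    fun c => ?_⟩
  · have h := congrFun (congrFun (Unitary.coe_mul_star_self hA.eigenvectorUnitary) x) y
    rw [Matrix.mul_apply, Matrix.one_apply] at h
    rw [← h, ← e.sum_comp]
    rfl
  · have h := congrFun (hA.mulVec_eigenvectorBasis (e j)) x
    simpa [Matrix.mulVec, dotProduct, SimpleGraph.adjMatrix_apply] using h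
  · have h : c • K.adjMatrix ℝ = (hA.eigenvectorUnitary : Matrix F F ℝ) *
        Matrix.diagonal (fun x => c * hA.eigenvalues x) *
          star (hA.eigenvectorUnitary : Matrix F F ℝ) := by
      have h2 : Matrix.diagonal (fun x => c * hA.eigenvalues x) =
          c • Matrix.diagonal (RCLike.ofReal ∘ hA.eigenvalues) := by
        rw [← Matrix.diagonal_smul]
        rfl
      conv_lhs => rw [hA.spectral_theorem]
      rw [h2, Unitary.conjStarAlgAut_apply, Matrix.mul_smul, Matrix.smul_mul]
    rw [h, Matrix.charpoly_mul_comm, ← mul_assoc, Unitary.coe_star_mul_self, one_mul,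
      Matrix.charpoly_diagonal, ← e.prod_comp]
    rfl

theorem Matrix.exists_eq_iff_of_charpoly_eq_prod {F ι K : Type*} [Fintype F] [DecidableEq F]
    [Fintype ι] [Field K] {A : Matrix F F K} {μ : ι → K}
    (h : A.charpoly = ∏ j, (Polynomial.X - Polynomial.C (μ j))) (x : K) :
    (∃ j, μ j = x) ↔ ∃ v ≠ 0, A.mulVec v = x • v := by
  have h1 : (∃ j, μ j = x) ↔ A.charpoly.eval x = 0 := by
    rw [h, Polynomial.eval_prod, Finset.prod_eq_zero_iff]
    simp [sub_eq_zero, eq_comm]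
  rw [h1, Matrix.eval_charpoly, ← Matrix.exists_mulVec_eq_zero_iff]
  refine exists_congr fun v => and_congr_right fun _ => ?_
  rw [Matrix.sub_mulVec, sub_eq_zero, eq_comm]
  simp [Matrix.scalar_apply]

/-! ### The tensor product with the infinite path as a periodic graph -/

/-- The points `n + c x` are distinct: `n` is the integer part and `c x` the fractional part. -/
theorem intCast_add_inj_of_mem_Ico {F : Type*} {c : F → ℝ} (hc : Function.Injective c)
    (hc01 : ∀ x, c x ∈ Set.Ico (0 : ℝ) 1) {u v : ℤ × F} :
    (u.1 : ℝ) + c u.2 = v.1 + c v.2 ↔ u = v := by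
  refine ⟨fun h => ?_, fun h => h ▸ rfl⟩
  obtain ⟨m, x⟩ := u
  obtain ⟨n, y⟩ := v
  have hmn : m = n := by
    have h2 := congrArg Int.floor h
    rwa [Int.floor_intCast_add, Int.floor_intCast_add, Int.floor_eq_zero_iff.2 (hc01 x),
      Int.floor_eq_zero_iff.2 (hc01 y), add_zero, add_zero] at h2
  subst hmn
  exact Prod.ext rfl (hc (add_left_cancel h))

theorem EuclideanSpace.single_add_basisFun (x : ℝ) (i : Fin 1) :
    EuclideanSpace.single (0 : Fin 1) x + (EuclideanSpace.basisFun (Fin 1) ℝ).toBasis i =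
      EuclideanSpace.single 0 (x + 1) := by
  ext j
  fin_cases i; fin_cases j
  simp

theorem EuclideanSpace.single_zero_inj {x y : ℝ} :
    EuclideanSpace.single (0 : Fin 1) x = EuclideanSpace.single 0 y ↔ x = y := by
  refine ⟨fun h => ?_, fun h => h ▸ rfl⟩
  simpa using congrArg (fun v : EuclideanSpace ℝ (Fin 1) => v 0) h

theorem EuclideanSpace.basisFun_repr_single (x : ℝ) (i : Fin 1) :
    (EuclideanSpace.basisFun (Fin 1) ℝ).toBasis.repr (EuclideanSpace.single 0 x) i = x := by
  fin_cases i
  simp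

/-- The realization in `ℝ` of the tensor product of the two-sided infinite path with a finite graph
`K` that puts the vertex `(n, x)` at the point `n + c x`, with `0 ≤ c x < 1`. -/
noncomputable def SimpleGraph.tensorProductRealization {F : Type} [Finite F] (K : SimpleGraph F)
    (hconn : ((SimpleGraph.hasse ℤ).tensorProduct K).Connected) {c : F → ℝ}
    (hc : Function.Injective c) (hc01 : ∀ x, c x ∈ Set.Ico (0 : ℝ) 1) :
    PeriodicGraph ((SimpleGraph.hasse ℤ).tensorProduct K) 1 where
  pos v := EuclideanSpace.single 0 (v.1 + c v.2)
  a := (EuclideanSpace.basisFun (Fin 1) ℝ).toBasis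
  pos_injective u v h := by
    rwa [EuclideanSpace.single_zero_inj, intCast_add_inj_of_mem_Ico hc hc01] at h
  exists_add i v := by
    refine ⟨(v.1 + 1, v.2), ?_⟩
    rw [EuclideanSpace.single_add_basisFun]
    push_cast
    ring_nf
  exists_sub i v := by
    refine ⟨(v.1 - 1, v.2), ?_⟩
    rw [eq_sub_iff_add_eq, EuclideanSpace.single_add_basisFun]
    push_cast
    ring_nf
  adj_translate i u v u' v' hu hv := by
    have key : ∀ {u u' : ℤ × F}, EuclideanSpace.single (0 : Fin 1) (u'.1 + c u'.2) =
        EuclideanSpace.single 0 (u.1 + c u.2) + (EuclideanSpace.basisFun (Fin 1) ℝ).toBasis i →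
        u' = (u.1 + 1, u.2) := by
      intro u u' h
      rw [EuclideanSpace.single_add_basisFun, EuclideanSpace.single_zero_inj] at h
      rw [← intCast_add_inj_of_mem_Ico hc hc01, h]
      push_cast
      ring
    rw [key hu, key hv, SimpleGraph.tensorProduct_adj, SimpleGraph.tensorProduct_adj,
      SimpleGraph.hasse_int_adj, SimpleGraph.hasse_int_adj]
    refine and_congr_left fun _ => ?_
    simp only
    omega
  finite_cell := by
    refine ((Set.finite_singleton (0 : ℤ)).prod (Set.finite_univ (α := F))).subset ?_
    rintro ⟨n, x⟩ h
    have h0 := (ZSpan.mem_fundamentalDomain _).1 h 0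
    rw [EuclideanSpace.basisFun_repr_single] at h0
    have h1 := Int.floor_eq_zero_iff.2 h0
    rw [Int.floor_intCast_add, Int.floor_eq_zero_iff.2 (hc01 x), add_zero] at h1
    exact ⟨h1, trivial⟩
  finite_neighbors v := by
    refine ((Set.toFinite {v.1 + 1, v.1 - 1}).prod (Set.finite_univ (α := F))).subset ?_
    rintro u h
    exact ⟨SimpleGraph.hasse_int_adj.1 h.1, trivial⟩
  connected := hconn

section tensorProductRealization

variable {F : Type} {K : SimpleGraph F}
  {hconn : ((SimpleGraph.hasse ℤ).tensorProduct K).Connected} {c : F → ℝ}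
  {hc : Function.Injective c} {hc01 : ∀ x, c x ∈ Set.Ico (0 : ℝ) 1}

theorem SimpleGraph.tensorProductRealization_pos [Finite F] (v : ℤ × F) :
    (K.tensorProductRealization hconn hc hc01).pos v = EuclideanSpace.single 0 (v.1 + c v.2) := rfl

theorem SimpleGraph.tensorProductRealization_a [Finite F] :
    (K.tensorProductRealization hconn hc hc01).a = (EuclideanSpace.basisFun (Fin 1) ℝ).toBasis := rfl

theorem SimpleGraph.tensorProductRealization_pos_add_one [Finite F] (n : ℤ) (x : F) :
    (K.tensorProductRealization hconn hc hc01).pos (n + 1, x) =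
      (K.tensorProductRealization hconn hc hc01).pos (n, x) +
        (K.tensorProductRealization hconn hc hc01).a 0 := by
  rw [tensorProductRealization_a, tensorProductRealization_pos, tensorProductRealization_pos,
    EuclideanSpace.single_add_basisFun]
  push_cast
  ring_nf

theorem SimpleGraph.tensorProductRealization_cellIndex [Finite F] (v : ℤ × F) (i : Fin 1) :
    (K.tensorProductRealization hconn hc hc01).cellIndex v i = v.1 := by
  rw [PeriodicGraph.cellIndex, tensorProductRealization_a, tensorProductRealization_pos,
    EuclideanSpace.basisFun_repr_single, Int.floor_intCast_add,
    Int.floor_eq_zero_iff.2 (hc01 _), add_zero]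

theorem SimpleGraph.tensorProductRealization_fract [Finite F] (v : ℤ × F) :
    ZSpan.fract (K.tensorProductRealization hconn hc hc01).a
      ((K.tensorProductRealization hconn hc hc01).pos v) =
      (K.tensorProductRealization hconn hc hc01).pos (0, v.2) := by
  refine (K.tensorProductRealization hconn hc hc01).a.repr.injective (Finsupp.ext fun i => ?_)
  rw [ZSpan.repr_fract_apply, tensorProductRealization_a, tensorProductRealization_pos,
    tensorProductRealization_pos, EuclideanSpace.basisFun_repr_single,
    EuclideanSpace.basisFun_repr_single, Int.fract_intCast_add, Int.fract_eq_self.2 (hc01 _)]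
  simp

theorem SimpleGraph.tensorProductRealization_crystal [Finite F] :
    (K.tensorProductRealization hconn hc hc01).crystal = {v | v.1 = 0} := by
  ext v
  rw [PeriodicGraph.crystal, Set.mem_ofPred_eq, Set.mem_ofPred_eq, ← ZSpan.fract_eq_self,
    tensorProductRealization_fract, (PeriodicGraph.pos_injective _).eq_iff, Prod.ext_iff]
  simp [eq_comm]

theorem PeriodicGraph.mem_nbrs {V : Type} {G : SimpleGraph V} {d : ℕ} (Γ : PeriodicGraph G d)
    (v u : V) : u ∈ Γ.nbrs v ↔ G.Adj v u := by
  simp [PeriodicGraph.nbrs]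

/-- The Floquet matrix of the tensor product of the two-sided infinite path with `K` is
`2 cos (2 π θ)` times the adjacency matrix of `K`. -/
theorem SimpleGraph.isFloquetEigenvalues_tensorProductRealization [Fintype F] [DecidableEq F]
    [DecidableRel K.Adj] {k : ℕ} {μ : Fin k → ℝ}
    (hμ : ∀ r : ℝ, (r • K.adjMatrix ℝ).charpoly =
      ∏ j, (Polynomial.X - Polynomial.C (r * μ j))) :
    (K.tensorProductRealization hconn hc hc01).IsFloquetEigenvalues (fun _ => 0)
      fun j θ => 2 * μ j * Real.cos (2 * Real.pi * θ 0) := by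
  intro θ
  set Γ := K.tensorProductRealization hconn hc hc01 with hΓ
  have hcr : ∀ v : ℤ × F, v ∈ Γ.crystal ↔ v.1 = 0 := fun v => by
    rw [hΓ, tensorProductRealization_crystal]; rfl
  let e : F ≃ Γ.crystal :=
    { toFun := fun x => ⟨(0, x), (hcr _).2 rfl⟩
      invFun := fun v => v.1.2
      left_inv := fun x => rfl
      right_inv := fun v => Subtype.ext (Prod.ext ((hcr _).1 v.2).symm rfl) }
  set r : ℝ := 2 * Real.cos (2 * Real.pi * θ 0) with hr
  have hmat : Γ.floquetMatrix (fun _ => 0) θ =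
      Matrix.reindex e e ((r • K.adjMatrix ℝ).map Complex.ofRealHom) := by
    ext v w
    obtain ⟨x, rfl⟩ := e.surjective v
    obtain ⟨y, rfl⟩ := e.surjective w
    have hfr : ∀ (m : ℤ) (z : F), ZSpan.fract Γ.a (Γ.pos (m, z)) = Γ.pos (e y) ↔ z = y := by
      intro m z
      have h := tensorProductRealization_fract (hconn := hconn) (hc := hc) (hc01 := hc01) (m, z)
      rw [← hΓ] at h
      rw [h, Γ.pos_injective.eq_iff]
      simp [e]
    have hph : ∀ (m : ℤ) (z : F), (∑ i, θ i * Γ.cellIndex (m, z) i : ℝ) = θ 0 * m := by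
      intro m z
      simp [hΓ, tensorProductRealization_cellIndex]
    have hcos : Complex.exp (2 * Real.pi * Complex.I * ((θ 0 * (0 + 1 : ℤ) : ℝ) : ℂ)) +
        Complex.exp (2 * Real.pi * Complex.I * ((θ 0 * (0 - 1 : ℤ) : ℝ) : ℂ)) = (r : ℂ) := by
      rw [hr]
      push_cast
      rw [Complex.two_cos]
      congr 2 <;> ring
    rw [PeriodicGraph.floquetMatrix, Matrix.of_apply,
      SimpleGraph.sum_tensorProduct_hasse_int (N := Γ.nbrs (e x)) (n := 0) (x := x)
        (fun u => Γ.mem_nbrs _ u)]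
    simp only [hfr, hph, Complex.ofReal_zero, ite_self, add_zero]
    rw [Finset.sum_eq_single y]
    · simp only [if_true, hcos]
      simp only [Matrix.reindex_apply, Matrix.submatrix_apply, Equiv.symm_apply_apply,
        Matrix.map_apply, Matrix.smul_apply, SimpleGraph.adjMatrix_apply]
      split_ifs <;> simp
    · intro z _ hz
      simp [hz]
    · simp
  have hch : (Γ.floquetMatrix (fun _ => 0) θ).charpoly =
      ((r • K.adjMatrix ℝ).map Complex.ofRealHom).charpoly := by
    rw [hmat]
    convert Matrix.charpoly_reindex e ((r • K.adjMatrix ℝ).map Complex.ofRealHom)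
  refine Eq.trans (b := ((r • K.adjMatrix ℝ).map Complex.ofRealHom).charpoly) (by convert hch) ?_
  rw [Matrix.charpoly_map, hμ, Polynomial.map_prod]
  refine Finset.prod_congr rfl fun j _ => ?_
  rw [Polynomial.map_sub, Polynomial.map_X, Polynomial.map_C, hr]
  congr 2
  rw [Complex.ofRealHom_eq_coe]
  congr 1
  ring

theorem SimpleGraph.hasPurelyACSpectrum_tensorProductRealization [Fintype F] [DecidableEq F]
    [DecidableRel K.Adj] {k : ℕ} {μ : Fin k → ℝ}
    (hμ : ∀ j, μ j ≠ 0) {O : F → Fin k → ℝ}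
    (hO : ∀ x y, ∑ j, O x j * O y j = if x = y then 1 else 0)
    (hK : ∀ x j, (∑ y, if K.Adj x y then O y j else 0) = μ j * O x j) :
    (K.tensorProductRealization hconn hc hc01).HasPurelyACSpectrum (fun _ => 0) := by
  obtain ⟨T, hT, hac⟩ := exists_isPurelyAbsolutelyContinuous_tensorProduct_hasse_int hμ hO hK
    (K.tensorProductRealization hconn hc hc01).mem_nbrs
  refine ⟨T, fun ψ v => ?_, hac⟩
  rw [hT, Complex.ofReal_zero, zero_mul, add_zero]

end tensorProductRealization

/-! ### The graph `C₃ □ P₄` -/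

/-- The tensor product of the two-sided infinite path with a connected graph is connected as soon as
every vertex of the latter lies on a triangle: going around the triangle along the path leads from
`(n, x)` to `(n + 1, x)`. -/
theorem SimpleGraph.connected_tensorProduct_hasse_int {F : Type*} {K : SimpleGraph F}
    (hK : K.Connected) (htri : ∀ x, ∃ y z, K.Adj x y ∧ K.Adj y z ∧ K.Adj z x) :
    ((SimpleGraph.hasse ℤ).tensorProduct K).Connected := by
  have hstep : ∀ (n : ℤ) {x y : F}, K.Adj x y →
      ((SimpleGraph.hasse ℤ).tensorProduct K).Reachable (n, x) (n + 1, y) := fun n x y h =>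
    SimpleGraph.Adj.reachable ⟨hasse_int_adj.2 (Or.inl rfl), h⟩
  have hsucc : ∀ (n : ℤ) (x : F),
      ((SimpleGraph.hasse ℤ).tensorProduct K).Reachable (n, x) (n + 1, x) := by
    intro n x
    obtain ⟨y, z, hxy, hyz, hzx⟩ := htri x
    exact (hstep n hxy).trans ((hstep n hyz.symm).symm.trans (hstep n hzx))
  have hline : ∀ (n : ℤ) (x : F),
      ((SimpleGraph.hasse ℤ).tensorProduct K).Reachable (0, x) (n, x) := by
    intro n x
    induction n using Int.induction_on with
    | zero => exact .rfl
    | succ n ih => exact ih.trans (hsucc _ x)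
    | pred n ih => exact ih.trans (by simpa using (hsucc (-(n : ℤ) - 1) x).symm)
  have hfib : ∀ {x y : F}, K.Reachable x y →
      ((SimpleGraph.hasse ℤ).tensorProduct K).Reachable (0, x) (0, y) := by
    rintro x y ⟨p⟩
    induction p with
    | nil => exact .rfl
    | cons h _ ih => exact ((hstep 0 h).trans (hsucc 0 _).symm).trans ih
  have : Nonempty F := hK.nonempty
  refine ⟨fun u v => ?_⟩
  exact (hline u.1 u.2).symm.trans ((hfib (hK.preconnected u.2 v.2)).trans (hline v.1 v.2))

theorem cycleBoxPath_adj {x y : Fin 3 × Fin 4} : cycleBoxPath.Adj x y ↔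
    (x.1 ≠ y.1 ∧ x.2 = y.2) ∨
      (((x.2 : ℕ) + 1 = y.2 ∨ (y.2 : ℕ) + 1 = x.2) ∧ x.1 = y.1) := by
  have h : ∀ i j : Fin 3, (i - j = 1 ∨ j - i = 1) ↔ i ≠ j := by decide
  rw [cycleBoxPath, SimpleGraph.boxProd_adj, SimpleGraph.cycleGraph_adj, SimpleGraph.pathGraph_adj,
    h]

theorem cycleBoxPath_connected : cycleBoxPath.Connected :=
  SimpleGraph.cycleGraph_connected.boxProd (SimpleGraph.pathGraph_connected 3)

theorem counterexampleGraph_connected : counterexampleGraph.Connected := by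
  refine SimpleGraph.connected_tensorProduct_hasse_int cycleBoxPath_connected fun x => ?_
  refine ⟨(x.1 + 1, x.2), (x.1 + 2, x.2), ?_⟩
  have h : ∀ i : Fin 3, i ≠ i + 1 ∧ i + 1 ≠ i + 2 ∧ i + 2 ≠ i := by decide
  simp [cycleBoxPath_adj, h]

/-- The other two vertices of the triangle through `x` are `(x.1 + 1, x.2)` and `(x.1 + 2, x.2)`. -/
theorem cycleBoxPath_mulVec [DecidableRel cycleBoxPath.Adj] (v : Fin 3 × Fin 4 → ℝ) :
    (cycleBoxPath.adjMatrix ℝ).mulVec v = fun x =>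
      v (x.1 + 1, x.2) + v (x.1 + 2, x.2) +
        ![v (x.1, 1), v (x.1, 0) + v (x.1, 2), v (x.1, 1) + v (x.1, 3), v (x.1, 2)] x.2 := by
  ext ⟨i, l⟩
  simp only [Matrix.mulVec, dotProduct, SimpleGraph.adjMatrix_apply, cycleBoxPath_adj,
    Fintype.sum_prod_type]
  fin_cases i <;> fin_cases l <;> simp [Fin.sum_univ_succ] <;> ring

/-- If `α` is an eigenvalue of `C₃` with eigenvector `f` and `t² + t = 1`, so that `t` is an
eigenvalue of `P₄` with eigenvector `(1, t, -t, -1)`, then `α + t` is an eigenvalue of `C₃ □ P₄`. -/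
theorem cycleBoxPath_mulVec_eigenvector [DecidableRel cycleBoxPath.Adj] {α t : ℝ} {f : Fin 3 → ℝ}
    (hf : ∀ i, f (i + 1) + f (i + 2) = α * f i) (ht : t ^ 2 + t = 1) :
    (cycleBoxPath.adjMatrix ℝ).mulVec (fun x => f x.1 * ![1, t, -t, -1] x.2) =
      (α + t) • fun x => f x.1 * ![1, t, -t, -1] x.2 := by
  rw [cycleBoxPath_mulVec]
  ext ⟨i, l⟩
  have h := hf i
  fin_cases l <;> simp
  · linear_combination h
  · linear_combination t * h - f i * ht
  · linear_combination f i * ht - t * h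
  · linear_combination -h

/-- `0` is not an eigenvalue of `C₃ □ P₄`. -/
theorem cycleBoxPath_mulVec_eq_zero [DecidableRel cycleBoxPath.Adj] {v : Fin 3 × Fin 4 → ℝ}
    (hv : (cycleBoxPath.adjMatrix ℝ).mulVec v = 0) : v = 0 := by
  rw [cycleBoxPath_mulVec] at hv
  have h := fun i l => congrFun hv (i, l)
  simp only [Pi.zero_apply] at h
  have h00 := h 0 0
  have h01 := h 0 1
  have h02 := h 0 2
  have h03 := h 0 3
  have h10 := h 1 0
  have h11 := h 1 1
  have h12 := h 1 2
  have h13 := h 1 3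
  have h20 := h 2 0
  have h21 := h 2 1
  have h22 := h 2 2
  have h23 := h 2 3
  simp at h00 h01 h02 h03 h10 h11 h12 h13 h20 h21 h22 h23
  ext ⟨i, l⟩
  fin_cases i <;> fin_cases l <;> simp <;> linarith

theorem exists_eigenvalue_cycleBoxPath [DecidableRel cycleBoxPath.Adj] {ι : Type*} [Fintype ι]
    {μ : ι → ℝ} (hμ : (cycleBoxPath.adjMatrix ℝ).charpoly =
      ∏ j, (Polynomial.X - Polynomial.C (μ j)))
    {α t : ℝ} {f : Fin 3 → ℝ} (hf : ∀ i, f (i + 1) + f (i + 2) = α * f i) (hf0 : f 0 = 1)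
    (ht : t ^ 2 + t = 1) : ∃ j, μ j = α + t := by
  refine (Matrix.exists_eq_iff_of_charpoly_eq_prod hμ _).2
    ⟨_, fun h0 => ?_, cycleBoxPath_mulVec_eigenvector hf ht⟩
  simpa [hf0] using congrFun h0 (0, 0)

theorem proposition1p5 :
    (∃ (d : ℕ) (V : Type) (G : SimpleGraph V) (Γ : PeriodicGraph G d) (Q : V → ℝ),
      0 < d ∧ Γ.IsPeriodicPotential Q ∧
      Γ.HasPurelyACSpectrum Q ∧ ¬ Γ.SatisfiesFloquetAssumption Q) ∧
    (∃ Γ : PeriodicGraph counterexampleGraph 1,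
      (∀ (n : ℤ) (x : Fin 3 × Fin 4), Γ.pos (n + 1, x) = Γ.pos (n, x) + Γ.a 0) ∧
      Γ.crystal = {v | v.1 = 0} ∧
      Γ.HasPurelyACSpectrum (fun _ => 0) ∧
      ¬ Γ.SatisfiesFloquetAssumption (fun _ => 0) ∧
      ∃ μ : Fin 12 → ℝ,
        IsAdjacencySpectrum cycleBoxPath μ ∧
        Γ.IsFloquetEigenvalues (fun _ => 0)
          (fun j θ => 2 * μ j * Real.cos (2 * Real.pi * θ 0)) ∧
        (∀ j, μ j ≠ 0) ∧
        ∃ j k, μ j = (3 + Real.sqrt 5) / 2 ∧ μ k = -((3 + Real.sqrt 5) / 2)) := by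
  classical
  obtain ⟨μ, O, hO, hK, hch⟩ :=
    cycleBoxPath.exists_orthonormal_eigenbasis (finProdFinEquiv (m := 3) (n := 4)).symm
  have hspec : (cycleBoxPath.adjMatrix ℝ).charpoly =
      ∏ j, (Polynomial.X - Polynomial.C (μ j)) := by simpa using hch 1
  have hμ0 : ∀ j, μ j ≠ 0 := by
    intro j hj
    obtain ⟨v, hv0, hv⟩ := (Matrix.exists_eq_iff_of_charpoly_eq_prod hspec 0).1 ⟨j, hj⟩
    rw [zero_smul] at hv
    exact hv0 (cycleBoxPath_mulVec_eq_zero hv)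
  -- the eigenvalues `2` and `-1` of `C₃` are combined with the two roots of `t ^ 2 + t = 1`
  have h5 : Real.sqrt 5 ^ 2 = 5 := Real.sq_sqrt (by norm_num)
  obtain ⟨j, hj⟩ := exists_eigenvalue_cycleBoxPath hspec (α := 2) (t := (Real.sqrt 5 - 1) / 2)
    (f := fun _ => 1) (fun _ => by norm_num) rfl (by linear_combination h5 / 4)
  obtain ⟨k, hk⟩ := exists_eigenvalue_cycleBoxPath hspec (α := -1) (t := -(Real.sqrt 5 + 1) / 2)
    (f := ![1, -1, 0]) (fun i => by fin_cases i <;> simp) rfl (by linear_combination h5 / 4)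
  have hj' : μ j = (3 + Real.sqrt 5) / 2 := by rw [hj]; ring
  have hk' : μ k = -((3 + Real.sqrt 5) / 2) := by rw [hk]; ring
  have hc : Function.Injective fun x : Fin 3 × Fin 4 => ((finProdFinEquiv x : ℕ) : ℝ) / 12 := by
    intro x y h
    have h' : ((finProdFinEquiv x : ℕ) : ℝ) = (finProdFinEquiv y : ℕ) := by
      simpa [div_left_inj'] using h
    exact finProdFinEquiv.injective (Fin.ext (by exact_mod_cast h'))
  have hc01 : ∀ x : Fin 3 × Fin 4, ((finProdFinEquiv x : ℕ) : ℝ) / 12 ∈ Set.Ico (0 : ℝ) 1 := by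
    intro x
    have hx : ((finProdFinEquiv x : ℕ) : ℝ) < 12 := by exact_mod_cast (finProdFinEquiv x).isLt
    exact ⟨by positivity, by rw [div_lt_one (by norm_num)]; exact hx⟩
  let Γ : PeriodicGraph counterexampleGraph 1 :=
    cycleBoxPath.tensorProductRealization counterexampleGraph_connected hc hc01
  have hAC : Γ.HasPurelyACSpectrum (fun _ => 0) :=
    SimpleGraph.hasPurelyACSpectrum_tensorProductRealization hμ0 hO hK
  have hE : Γ.IsFloquetEigenvalues (fun _ => 0)
      (fun j θ => 2 * μ j * Real.cos (2 * Real.pi * θ 0)) :=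
    SimpleGraph.isFloquetEigenvalues_tensorProductRealization hch
  -- `cos (2 π (θ + 1/2)) = -cos (2 π θ)` and `μ j = -μ k`
  have hF : ¬ Γ.SatisfiesFloquetAssumption (fun _ => 0) := by
    refine PeriodicGraph.not_satisfiesFloquetAssumption_of_half_period one_pos hE
      (j := j) (k := k) fun θ => ?_
    have h1 : 2 * Real.pi * (θ 0 + 1 / 2) = 2 * Real.pi * θ 0 + Real.pi := by ring
    simp only
    rw [h1, Real.cos_add_pi, hj', hk']
    ring
  refine ⟨⟨1, _, counterexampleGraph, Γ, fun _ => 0, one_pos, fun _ _ _ _ => rfl, hAC, hF⟩,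
    Γ, fun n x => SimpleGraph.tensorProductRealization_pos_add_one n x,
    SimpleGraph.tensorProductRealization_crystal, hAC, hF, μ, ?_, hE, hμ0, j, k, hj', hk'⟩
  rw [IsAdjacencySpectrum]
  convert hspec
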